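/- **Definitions.** A *foliage tree* $\mathbf F$ on a set $X$ consists of a tree (a partially ordered set of nodes in which the strict predecessors of every node are well-ordered) and, for each node $v$, a set $\mathbf F_v\subseteq X$, the *leaf* at $v$. The *height* of $v$ is the order type of the set of strict predecessors of $v$; the *sons* of $v$ are its immediate successors; a *branch* is a maximal chain of nodes. Let $\mathrm{shoot}_{\mathbf F}(v)$ be the family of all sets $\bigcup_{s\in C}\mathbf F_s$, where $C$ is a cofinite subset of the set of sons of $v$. For families of sets, $\gamma\gg\delta$ ("$\gamma$ $\pi$-refines $\delta$") means that every nonempty $D\in\delta$ contains some nonempty $G\in\gamma$; and $\gamma$ has the FIP if every nonempty finite subfamily of $\gamma$ has nonempty intersection. A foliage tree $\mathbf F$ is a *$\pi$-tree* on a topological space $X$ if 1. its tree of nodes is isomorphic to the tree of finite sequences of natural numbers ordered by extension; 2. every leaf is open in $X$, and the leaf at the least node is $X$; 3. for every node $v$ that is not maximal, $\mathbf F_v$ is the disjoint union of the leaves at the sons of $v$; 4. for every branch $B$, $\bigcap_{v\in B}\mathbf F_v$ is a singleton; 5. for every $p\in X$ and every (not necessarily open) neighbourhood $U$ of $p$ there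 is a node $v$ with $p\in\mathbf F_v$ and $\mathrm{shoot}_{\mathbf F}(v)\gg\{U\}$. In a $\pi$-tree all heights are natural numbers. For $p\in X$ and a neighbourhood $U$ of $p$ put $$\mathrm{rise}_{\mathbf F}(p,U)=\{\mathrm{height}(v): p\in\mathbf F_v\text{ and }\mathrm{shoot}_{\mathbf F}(v)\gg\{U\}\}\subseteq\omega,$$ and let $\mathrm{Rise}_{\mathbf F}(X)$ be the family of all sets $\mathrm{rise}_{\mathbf F}(p,U)$ with $p\in X$ and $U$ a neighbourhood of $p$. **Theorem.** (a) Let $1\le|A|\le\omega$ and, for every $\alpha\in A$, let $\mathbf F(\alpha)$ be a $\pi$-tree on a topological space $X_\alpha$. Suppose that for each $\alpha\in A$ there is a family $\gamma_\alpha\subseteq\mathcal P(\omega)$ such that $|\gamma_\alpha|\le\omega$, $\gamma_\alpha$ has the FIP, and $\gamma_\alpha\gg\mathrm{Rise}_{\mathbf F(\alpha)}(X_\alpha)$. Then the product space $\prod_{\alpha\in A}X_\alpha$ has a $\pi$-tree. (b) Suppose, in addition to the assumptions of (a), that $\mathbf G$ is a $\pi$-tree on a topological space $Y$ and $\mathrm{Rise}_{\mathbf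 G}(Y)$ has the FIP. Then the product space $Y\times\prod_{\alpha\in A}X_\alpha$ also has a $\pi$-tree. -/

import Mathlib

open Set Topology

universe u v

/-- A foliage tree whose leaves are subsets of `X`: a partial order of nodes in which the strict
predecessors of every node are well-ordered (a set-theoretic tree, the *skeleton*), together with a
leaf `leaf x ⊆ X` for each node `x`. -/
structure FoliageTree (X : Type u) where
  Node : Type v
  [order : PartialOrder Node]
  wellOrdered : ∀ x : Node, IsWellOrder (Iio x) (· < ·)
  leaf : Node → Set X

attribute [instance] FoliageTree.order

/-- `γ` has the finite intersection property: every nonempty finite subfamily has nonempty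
intersection. -/
def HasFIP {S : Type*} (γ : Set (Set S)) : Prop :=
  ∀ δ : Set (Set S), δ ⊆ γ → δ.Finite → δ.Nonempty → (⋂₀ δ).Nonempty

/-- `γ ≫ δ`: the family `γ` π-refines the family `δ`. -/
def PiRefines {S : Type*} (γ δ : Set (Set S)) : Prop :=
  ∀ D ∈ δ, D.Nonempty → ∃ G ∈ γ, G.Nonempty ∧ G ⊆ D

namespace FoliageTree

variable {X : Type u}

/-- The height of a node: the order type of the set of its strict predecessors. -/
noncomputable def height (F : FoliageTree.{u, v} X) (x : F.Node) : Ordinal.{v} :=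
  haveI := F.wellOrdered x
  Ordinal.type (fun a b : Iio x => a < b)

/-- The sons (immediate successors) of a node. -/
def sons (F : FoliageTree.{u, v} X) (x : F.Node) : Set F.Node := {s | x ⋖ s}

/-- The union of the leaves at the nodes of `C`. -/
def flesh (F : FoliageTree.{u, v} X) (C : Set F.Node) : Set X := ⋃ x ∈ C, F.leaf x

/-- The family of all `flesh C`, where `C` is a cofinite subset of the set of sons of `x`. -/
def shoot (F : FoliageTree.{u, v} X) (x : F.Node) : Set (Set X) :=
  {W | ∃ C : Set F.Node, C ⊆ F.sons x ∧ (F.sons x \ C).Finite ∧ W = F.flesh C}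

/-- The set of nodes whose leaf contains `p`. -/
def scope (F : FoliageTree.{u, v} X) (p : X) : Set F.Node := {x | p ∈ F.leaf x}

/-- For every branch (maximal chain), the intersection of the leaves along it is a singleton. -/
def HasStrictBranches (F : FoliageTree.{u, v} X) : Prop :=
  Nonempty F.Node ∧
    ∀ B : Set F.Node, IsMaxChain (· ≤ ·) B → ∃ p : X, (⋂ x ∈ B, F.leaf x) = {p}

/-- The leaf at each non-maximal node is the disjoint union of the leaves at its sons. -/
def LocallyStrict (F : FoliageTree.{u, v} X) : Prop :=
  ∀ x : F.Node, ¬ IsMax x →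
    F.leaf x = (⋃ s ∈ F.sons x, F.leaf s) ∧ (F.sons x).PairwiseDisjoint F.leaf

/-- The skeleton is order isomorphic to the tree of finite sequences of natural numbers, ordered by
extension (that is, by the prefix relation). -/
def IsOmegaOmegaTree (F : FoliageTree.{u, v} X) : Prop :=
  Nonempty ((fun x y : F.Node => x ≤ y) ≃r (fun s t : List ℕ => s <+: t))

/-- `rise_F(p, U)`: the heights of the nodes `x` such that `p ∈ F_x` and `shoot_F(x) ≫ {U}`.
Every node of a Baire foliage tree has finite height, so this is taken as a set of naturals. -/
def rise (F : FoliageTree.{u, v} X) (p : X) (U : Set X) : Set ℕ :=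
  {n | ∃ x ∈ F.scope p, PiRefines (F.shoot x) {U} ∧ F.height x = (n : Ordinal.{v})}

variable [TopologicalSpace X]

/-- `F` is a Baire foliage tree on the space `X`. -/
structure IsBaireFoliageTree (F : FoliageTree.{u, v} X) : Prop where
  isOpen_leaf : ∀ x : F.Node, IsOpen (F.leaf x)
  locallyStrict : F.LocallyStrict
  isOmegaOmegaTree : F.IsOmegaOmegaTree
  hasStrictBranches : F.HasStrictBranches
  leaf_root : ∃ r : F.Node, IsBot r ∧ F.leaf r = univ

/-- `F` grows into the space `X`. -/
def GrowsInto (F : FoliageTree.{u, v} X) : Prop :=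
  ∀ p : X, ∀ U ∈ 𝓝 p, ∃ z ∈ F.scope p, PiRefines (F.shoot z) {U}

/-- `F` is a π-tree on the space `X`. -/
structure IsPiTree (F : FoliageTree.{u, v} X) : Prop where
  isBaireFoliageTree : F.IsBaireFoliageTree
  growsInto : F.GrowsInto

/-- `Rise_F(X)`: the family of all `rise_F(p, U)` with `p ∈ X` and `U` a neighbourhood of `p`. -/
def riseFamily (F : FoliageTree.{u, v} X) : Set (Set ℕ) :=
  {R | ∃ p : X, ∃ U ∈ 𝓝 p, R = F.rise p U}

end FoliageTree

/-- The space `X` has a π-tree. (The node set of a π-tree is countable, so nothing is lost by taking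
it in `Type`.) -/
def HasPiTree (X : Type u) [TopologicalSpace X] : Prop :=
  ∃ F : FoliageTree.{u, 0} X, F.IsPiTree

/-! A π-tree on `X` amounts to a bijection of `X` with `ℕ → ℕ` whose coordinates are continuous and
for which every neighbourhood of every `p` satisfies `GrowsAt` at some `n` (`exists_coding`,
`hasPiTree_of_bijective`); every member of `rise p U` is such an `n`.

A basic neighbourhood in a product restricts finitely many factors, so one term of a single code
must force many terms to be large at once. A minimum does this. Term `2k` of the new code is the
minimum of the entries at the `k`-th levels over a finite set of factors, and term `2k+1` encodes
all entries of these factors below their next levels. The resulting set of sequences is closed and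
its tree is infinitely branching, so numbering the successors of each node yields all of `ℕ → ℕ`
(`hasPiTree_of_closed_range`, `hasPiTree_of_levels`).

The levels of a factor are a pseudo-intersection of its countable family: every neighbourhood grows
at all but finitely many of them, so finitely many factors share a `k`. The extra factor `Y` takes
every natural number as a level; growth at arbitrarily large ones suffices, since the other factors
grow at all late ones. -/

/-- All points that agree with `p` in the coordinates below `n`, and whose `n`-th coordinate is
large, belong to `U`. -/
def GrowsAt {X : Type*} (c : X → ℕ → ℕ) (p : X) (U : Set X) (n : ℕ) : Prop :=
  ∃ m, ∀ y, (∀ i < n, c y i = c p i) → m ≤ c y n → y ∈ U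

theorem GrowsAt.mono {X : Type*} {c : X → ℕ → ℕ} {p : X} {U V : Set X} {n : ℕ}
    (h : GrowsAt c p U n) (hUV : U ⊆ V) : GrowsAt c p V n := by
  obtain ⟨m, hm⟩ := h
  exact ⟨m, fun y h1 h2 => hUV (hm y h1 h2)⟩

/-- The finite sequence of the first `n` terms of `t`. -/
def initSeg (t : ℕ → ℕ) (n : ℕ) : List ℕ := (List.range n).map t

@[simp] theorem length_initSeg (t : ℕ → ℕ) (n : ℕ) : (initSeg t n).length = n := by
  simp [initSeg]

@[simp] theorem initSeg_zero (t : ℕ → ℕ) : initSeg t 0 = [] := rfl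

theorem initSeg_succ (t : ℕ → ℕ) (n : ℕ) : initSeg t (n + 1) = initSeg t n ++ [t n] := by
  simp [initSeg, List.range_succ]

theorem initSeg_eq_initSeg {t u : ℕ → ℕ} {n : ℕ} :
    initSeg t n = initSeg u n ↔ ∀ i < n, t i = u i := by
  simp [initSeg, List.map_inj_left]

theorem initSeg_prefix (t : ℕ → ℕ) {m n : ℕ} (h : m ≤ n) : initSeg t m <+: initSeg t n := by
  induction n, h using Nat.le_induction with
  | base => exact List.prefix_refl _
  | succ n _ ih => exact ih.trans (by rw [initSeg_succ]; exact List.prefix_append _ _)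

/-! ### From π-trees to codings -/

namespace FoliageTree

variable {X : Type u} {F : FoliageTree.{u, v} X}

theorem mem_sons_iff (e : (fun x y : F.Node => x ≤ y) ≃r (fun s t : List ℕ => s <+: t))
    {x y : F.Node} : y ∈ F.sons x ↔ ∃ i, e y = e x ++ [i] := by
  have hlt : ∀ a b : F.Node, a < b ↔ e a <+: e b ∧ e a ≠ e b := by
    intro a b
    rw [lt_iff_le_and_ne, ← e.map_rel_iff, ne_eq, ne_eq, e.injective.eq_iff]
  constructor
  · intro h
    have h' : x ⋖ y := h
    obtain ⟨h1, h2⟩ := (hlt _ _).1 h'.lt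
    obtain ⟨r, hr⟩ := h1
    rcases r with _ | ⟨i, r⟩
    · rw [List.append_nil] at hr
      exact absurd hr h2
    refine ⟨i, ?_⟩
    by_contra hne
    refine h'.2 (c := e.symm (e x ++ [i])) ?_ ?_
    · rw [hlt]; simp
    · rw [hlt]
      simp only [RelIso.apply_symm_apply]
      exact ⟨⟨r, by simp [← hr]⟩, fun h => hne h.symm⟩
  · rintro ⟨i, hi⟩
    refine ⟨by rw [hlt, hi]; simp, fun c h1 h2 => ?_⟩
    rw [hlt] at h1 h2
    have l1 : (e x).length < (e c).length := by
      refine lt_of_le_of_ne h1.1.length_le fun h => h1.2 (h1.1.eq_of_length h)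
    have l2 : (e c).length < (e y).length := by
      refine lt_of_le_of_ne h2.1.length_le fun h => h2.2 (h2.1.eq_of_length h)
    rw [hi] at l2
    simp at l2
    omega

theorem height_eq_length (e : (fun x y : F.Node => x ≤ y) ≃r (fun s t : List ℕ => s <+: t))
    (x : F.Node) : F.height x = ((e x).length : Ordinal.{v}) := by
  have := F.wellOrdered x
  -- The strict predecessors of a node are the proper initial segments of its sequence, one for each
  -- length.
  have hb : Function.Bijective
      (fun i : Fin (e x).length => (⟨e.symm ((e x).take i), by
        refine lt_of_le_of_ne ?_ ?_
        · rw [← e.map_rel_iff]; simp [List.take_prefix]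
        · intro h
          have := congrArg (fun y => (e y).length) h
          simp at this
          omega⟩ : Iio x)) := by
    constructor
    · intro i j hij
      have := congrArg (fun y : Iio x => (e y).length) hij
      simp at this
      ext; omega
    · rintro ⟨y, hy⟩
      have hp : e y <+: e x := e.map_rel_iff.2 (le_of_lt hy)
      have hl : (e y).length < (e x).length :=
        lt_of_le_of_ne hp.length_le fun h =>
          (ne_of_lt hy) (e.injective (hp.eq_of_length h))
      refine ⟨⟨_, hl⟩, Subtype.ext ?_⟩
      simp [← List.prefix_iff_eq_take.1 hp]
  let E := Equiv.ofBijective _ hb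
  let _ : Fintype (Iio x) := Fintype.ofEquiv _ E
  unfold height
  rw [Ordinal.type_fintype, ← Fintype.card_congr E, Fintype.card_fin]

theorem isMaxChain_range_initSeg
    (e : (fun x y : F.Node => x ≤ y) ≃r (fun s t : List ℕ => s <+: t)) (t : ℕ → ℕ) :
    IsMaxChain (· ≤ ·) (range fun n => e.symm (initSeg t n)) := by
  constructor
  · rintro _ ⟨m, rfl⟩ _ ⟨n, rfl⟩ _
    rcases le_total m n with h | h
    · left; exact e.symm.map_rel_iff.2 (initSeg_prefix t h)
    · right; exact e.symm.map_rel_iff.2 (initSeg_prefix t h)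
  · intro B hB hsub
    refine hsub.antisymm fun x hx => ⟨(e x).length, ?_⟩
    have hl : (e (e.symm (initSeg t (e x).length))).length = (e x).length := by simp
    rcases hB.total hx (hsub ⟨(e x).length, rfl⟩) with h | h
    · exact (e.injective ((e.map_rel_iff.2 h).eq_of_length hl.symm)).symm
    · exact e.injective ((e.map_rel_iff.2 h).eq_of_length hl)

variable [TopologicalSpace X]

/-- A space with a π-tree is coded by the irrationals. -/
theorem IsPiTree.exists_coding (hF : F.IsPiTree) :
    ∃ c : X ≃ (ℕ → ℕ), (∀ n, Continuous fun x => c x n) ∧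
      (∀ p, ∀ U ∈ 𝓝 p, ∀ n ∈ F.rise p U, GrowsAt c p U n) ∧
      ∀ p, ∀ U ∈ 𝓝 p, (F.rise p U).Nonempty := by
  obtain ⟨⟨hopen, hls, ⟨e⟩, ⟨_, hbr⟩, r, hr, hroot⟩, hgrow⟩ := hF
  set L : List ℕ → Set X := fun s => F.leaf (e.symm s) with hL
  have hLe : ∀ x, F.leaf x = L (e x) := fun x => by simp [hL]
  have hnil : L [] = univ := by
    have h1 : e r <+: e (e.symm []) := e.map_rel_iff.2 (hr _)
    have h2 : e r = [] := by simpa using h1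
    rw [← hroot, hLe, h2]
  have hmax : ∀ x : F.Node, ¬ IsMax x := by
    intro x hx
    have h1 : x ≤ e.symm (e x ++ [0]) := e.map_rel_iff.1 (by simp)
    have h2 := e.map_rel_iff.2 (hx h1)
    have := h2.length_le
    simp at this
  have hson : ∀ s i, e.symm (s ++ [i]) ∈ F.sons (e.symm s) := fun s i =>
    (mem_sons_iff e).2 ⟨i, by simp⟩
  have hsub : ∀ s i, L (s ++ [i]) ⊆ L s := by
    intro s i x hx
    change x ∈ F.leaf (e.symm s)
    rw [(hls _ (hmax _)).1]
    exact mem_biUnion (hson s i) hx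
  have hex : ∀ s x, x ∈ L s → ∃ i, x ∈ L (s ++ [i]) := by
    intro s x hx
    change x ∈ F.leaf (e.symm s) at hx
    rw [(hls _ (hmax _)).1] at hx
    simp only [mem_iUnion] at hx
    obtain ⟨y, hy, hxy⟩ := hx
    obtain ⟨i, hi⟩ := (mem_sons_iff e).1 hy
    rw [RelIso.apply_symm_apply] at hi
    exact ⟨i, by rwa [← hi, ← hLe]⟩
  have huniq : ∀ s i j x, x ∈ L (s ++ [i]) → x ∈ L (s ++ [j]) → i = j := by
    intro s i j x hi hj
    by_contra hne
    refine disjoint_left.1 ((hls (e.symm s) (hmax _)).2 (hson s i) (hson s j) ?_) hi hj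
    intro h
    exact hne (by simpa using e.symm.injective h)
  have hpt : ∀ t : ℕ → ℕ, ∃ x, (⋂ n, L (initSeg t n)) = {x} := by
    intro t
    obtain ⟨x, hx⟩ := hbr _ (isMaxChain_range_initSeg e t)
    exact ⟨x, by rw [← hx, biInter_range]⟩
  choose P hP using hpt
  have hPmem : ∀ t n, P t ∈ L (initSeg t n) := fun t n =>
    mem_iInter.1 (by rw [hP t]; rfl : P t ∈ ⋂ n, L (initSeg t n)) n
  have hPuniq : ∀ t x, (∀ n, x ∈ L (initSeg t n)) → x = P t := fun t x hx =>
    (by rw [← hP t]; exact mem_iInter.2 hx : x ∈ ({P t} : Set X))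
  have hagree : ∀ t u x n, x ∈ L (initSeg t n) → x ∈ L (initSeg u n) →
      initSeg t n = initSeg u n := by
    intro t u x n
    induction n with
    | zero => intros; rfl
    | succ n ih =>
      rw [initSeg_succ, initSeg_succ]
      intro h1 h2
      have := ih (hsub _ _ h1) (hsub _ _ h2)
      rw [this] at h1 ⊢
      rw [huniq _ _ _ _ h1 h2]
  have hbij : Function.Bijective P := by
    constructor
    · intro t u htu
      funext i
      exact initSeg_eq_initSeg.1
        (hagree t u (P t) (i + 1) (hPmem t _) (htu ▸ hPmem u _)) i (Nat.lt_succ_self i)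
    · intro x
      -- Descending from the root, always to a son whose leaf contains `x`, produces the code of
      -- `x`.
      choose! f hf using fun s => hex s x
      let s : ℕ → List ℕ := fun n => Nat.rec [] (fun _ s => s ++ [f s]) n
      have hs : ∀ n, s n = initSeg (fun n => f (s n)) n := by
        intro n
        induction n with
        | zero => rfl
        | succ n ih => rw [initSeg_succ, ← ih]
      have hx : ∀ n, x ∈ L (s n) := by
        intro n
        induction n with
        | zero => change x ∈ L []; rw [hnil]; trivial
        | succ n ih => exact hf _ ih
      exact ⟨_, (hPuniq (fun n => f (s n)) x fun n => hs n ▸ hx n).symm⟩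
  let c : X ≃ (ℕ → ℕ) := (Equiv.ofBijective P hbij).symm
  have hPc : ∀ x, P (c x) = x := (Equiv.ofBijective P hbij).apply_symm_apply
  have hmem : ∀ x n, x ∈ L (initSeg (c x) n) := fun x n => by
    have := hPmem (c x) n
    rwa [hPc] at this
  have hiff : ∀ x y n, y ∈ L (initSeg (c x) n) ↔ ∀ i < n, c y i = c x i := by
    intro x y n
    rw [← initSeg_eq_initSeg]
    exact ⟨fun h => hagree _ _ y n (hmem y n) h, fun h => h ▸ hmem y n⟩
  have hlist : ∀ x s, x ∈ L s → s = initSeg (c x) s.length := by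
    intro x s
    induction s using List.reverseRecOn with
    | nil => intro _; rfl
    | append_singleton s i ih =>
      intro h
      have h1 := ih (hsub _ _ h)
      have h2 := hmem x (s.length + 1)
      rw [initSeg_succ, ← h1] at h2
      rw [List.length_append, List.length_singleton, initSeg_succ, ← h1, huniq _ _ _ _ h h2]
  refine ⟨c, fun n => ?_, ?_, ?_⟩
  · rw [continuous_discrete_rng]
    intro k
    rw [isOpen_iff_mem_nhds]
    intro x hx
    filter_upwards [(hopen (e.symm (initSeg (c x) (n + 1)))).mem_nhds (hmem x (n + 1))] with y hy
    have := (hiff x y (n + 1)).1 hy n (Nat.lt_succ_self n)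
    exact this.trans hx
  · rintro p U hU n ⟨x, hx, hsh, hht⟩
    rw [height_eq_length e, Nat.cast_inj] at hht
    obtain ⟨_, ⟨C, hC, hfin, rfl⟩, -, hGU⟩ := hsh U rfl ⟨p, mem_of_mem_nhds hU⟩
    have hxp : e x = initSeg (c p) n := by
      rw [← hht]; exact hlist p _ (by rw [← hLe]; exact hx)
    have hfin' : {i | e.symm (initSeg (c p) n ++ [i]) ∈ F.sons x \ C}.Finite := by
      refine hfin.preimage (f := fun i => e.symm (initSeg (c p) n ++ [i])) ?_
      intro i _ j _ h
      simpa using e.symm.injective h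
    -- Only finitely many sons are omitted from `C`; beyond the largest omitted index every leaf
    -- lies in `U`.
    obtain ⟨m, hm⟩ := hfin'.bddAbove
    refine ⟨m + 1, fun y h1 h2 => hGU ?_⟩
    have hy := hmem y (n + 1)
    rw [initSeg_succ, initSeg_eq_initSeg.2 h1] at hy
    refine mem_biUnion (x := e.symm (initSeg (c p) n ++ [c y n])) ?_ hy
    by_contra hnot
    have := hm (show c y n ∈ {i | e.symm (initSeg (c p) n ++ [i]) ∈ F.sons x \ C} from
      ⟨(mem_sons_iff e).2 ⟨c y n, by simp [hxp]⟩, hnot⟩)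
    omega
  · intro p U hU
    obtain ⟨z, hz, hzU⟩ := hgrow p U hU
    exact ⟨(e z).length, z, hz, hzU, height_eq_length e z⟩

end FoliageTree

/-! ### From codings to π-trees -/

/-- The tree of finite sequences of natural numbers, ordered by extension. -/
def SeqTree : Type := List ℕ

namespace SeqTree

/-- The type synonym keeps the prefix order apart from the order already present on `List ℕ`. -/
instance : PartialOrder SeqTree where
  le s t := List.IsPrefix (α := ℕ) s t
  le_refl s := List.prefix_refl (α := ℕ) s
  le_trans _ _ _ h1 h2 := List.IsPrefix.trans (α := ℕ) h1 h2
  le_antisymm _ _ h1 h2 := List.IsPrefix.eq_of_length_le (show List.IsPrefix (α := ℕ) _ _ from h1) (List.IsPrefix.length_le h2)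

theorem le_iff {s t : SeqTree} : s ≤ t ↔ List.IsPrefix (α := ℕ) s t := Iff.rfl

theorem le_total_of_le {a b c : SeqTree} (h1 : a ≤ c) (h2 : b ≤ c) : a ≤ b ∨ b ≤ a :=
  List.prefix_or_prefix_of_prefix h1 h2

theorem length_lt {a b : SeqTree} (h : a < b) :
    List.length (α := ℕ) a < List.length (α := ℕ) b :=
  lt_of_le_of_ne (List.IsPrefix.length_le (le_iff.1 h.le)) fun hl =>
    h.ne (List.IsPrefix.eq_of_length (le_iff.1 h.le) hl)

theorem isWellOrder_Iio (x : SeqTree) : IsWellOrder (Iio x) (· < ·) where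
  trichotomous a b hab hba := by
    rcases le_total_of_le (le_of_lt a.2) (le_of_lt b.2) with h | h
    · exact (eq_or_lt_of_le (show a ≤ b from h)).resolve_right hab
    · exact ((eq_or_lt_of_le (show b ≤ a from h)).resolve_right hba).symm
  wf := Subrelation.wf (fun {a b} h => length_lt (show a.1 < b.1 from h))
    (measure fun a : Iio x => List.length (α := ℕ) a.1).wf

/-- Every branch of the tree of finite sequences is given by an infinite sequence. -/
theorem exists_initSeg_mem {B : Set SeqTree} (hB : IsMaxChain (· ≤ ·) B) :
    ∃ t : ℕ → ℕ, ∀ n, (initSeg t n : SeqTree) ∈ B := by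
  have hins : ∀ s : SeqTree, (∀ b ∈ B, s ≤ b ∨ b ≤ s) → s ∈ B := by
    intro s hs
    have := hB.2 (hB.1.insert fun b hb _ => hs b hb) (subset_insert s B)
    rw [this]; exact mem_insert _ _
  have hdown : ∀ s u : SeqTree, u ∈ B → s ≤ u → s ∈ B := by
    intro s u hu hsu
    refine hins s fun b hb => ?_
    rcases hB.1.total hb hu with h | h
    · exact le_total_of_le hsu h
    · exact Or.inl (hsu.trans h)
  have hnil : (([] : List ℕ) : SeqTree) ∈ B := hins _ fun b _ => Or.inl List.nil_prefix
  have hstep : ∀ s : List ℕ, (s : SeqTree) ∈ B → ∃ i, ((s ++ [i] : List ℕ) : SeqTree) ∈ B := by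
    intro s hs
    by_contra! hno
    -- If no son of `s` is in `B`, then all of `B` lies below `s`, and any son, say the one with
    -- index 0, could be added to the chain.
    refine hno 0 (hins _ fun b hb => Or.inr ?_)
    rcases hB.1.total hb hs with h | h
    · exact h.trans (List.prefix_append s [0])
    · obtain ⟨r, hr⟩ := h
      rcases r with _ | ⟨i, r⟩
      · rw [List.append_nil] at hr
        subst hr
        exact List.prefix_append s [0]
      · exact absurd (hdown _ b hb ⟨r, by simpa using hr⟩) (hno i)
  choose! f hf using hstep
  let s : ℕ → List ℕ := fun n => Nat.rec [] (fun _ s => s ++ [f s]) n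
  refine ⟨fun n => f (s n), fun n => ?_⟩
  have hs : ∀ n, s n = initSeg (fun n => f (s n)) n := by
    intro n
    induction n with
    | zero => rfl
    | succ n ih => rw [initSeg_succ, ← ih]
  rw [← hs]
  induction n with
  | zero => exact hnil
  | succ n ih => exact hf _ ih

end SeqTree

/-- The set of points whose code extends `s`. -/
def codeCylinder {X : Type*} (c : X → ℕ → ℕ) (s : List ℕ) : Set X :=
  {x | initSeg (c x) s.length = s}

theorem mem_codeCylinder_initSeg {X : Type*} {c : X → ℕ → ℕ} {t : ℕ → ℕ} {n : ℕ} {x : X} :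
    x ∈ codeCylinder c (initSeg t n) ↔ ∀ i < n, c x i = t i := by
  rw [← initSeg_eq_initSeg]
  simp [codeCylinder]

theorem exists_eq_initSeg (s : List ℕ) : ∃ t, s = initSeg t s.length := by
  refine ⟨fun i => s.getD i 0, List.ext_getElem (by simp) fun i h1 h2 => ?_⟩
  simp [initSeg, h1]

theorem mem_codeCylinder_append {X : Type*} {c : X → ℕ → ℕ} {s : List ℕ} {i : ℕ} {x : X} :
    x ∈ codeCylinder c (s ++ [i]) ↔ x ∈ codeCylinder c s ∧ c x s.length = i := by
  simp only [codeCylinder, mem_ofPred_eq, List.length_append, List.length_singleton,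
    initSeg_succ]
  constructor
  · intro h
    have := List.append_inj h (by simp)
    simpa using this
  · rintro ⟨h1, rfl⟩
    rw [h1]

/-- The leaves are the cylinders of the code, and `GrowsAt` says that the cofinitely many sons with
index at least `m` lie in `U`. -/
theorem hasPiTree_of_bijective {X : Type u} [TopologicalSpace X] (c : X → ℕ → ℕ)
    (hc : Function.Bijective c) (hcont : ∀ n, Continuous fun x => c x n)
    (hgrow : ∀ p, ∀ U ∈ 𝓝 p, ∃ n, GrowsAt c p U n) : HasPiTree X := by
  let F : FoliageTree.{u, 0} X :=
    { Node := SeqTree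
      wellOrdered := SeqTree.isWellOrder_Iio
      leaf := codeCylinder c }
  let e : (fun x y : F.Node => x ≤ y) ≃r (fun s t : List ℕ => s <+: t) :=
    ⟨Equiv.refl _, Iff.rfl⟩
  have hsons : ∀ s t : List ℕ, (t : F.Node) ∈ F.sons s ↔ ∃ i, t = s ++ [i] := fun s t =>
    FoliageTree.mem_sons_iff e
  refine ⟨F, ⟨fun s => ?_, fun s _ => ⟨?_, ?_⟩, ⟨e⟩, ⟨⟨([] : List ℕ)⟩, fun B hB => ?_⟩,
    ([] : List ℕ), fun s => List.nil_prefix, ?_⟩, fun p U hU => ?_⟩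
  · obtain ⟨t, ht⟩ := exists_eq_initSeg s
    have : F.leaf s = ⋂ i ∈ Finset.range (List.length (α := ℕ) s), (fun x => c x i) ⁻¹' {t i} := by
      ext x
      change x ∈ codeCylinder c s ↔ _
      rw [ht, mem_codeCylinder_initSeg]
      simp
    rw [this]
    exact isOpen_biInter_finset fun i _ => (isOpen_discrete _).preimage (hcont i)
  · ext x
    simp only [mem_iUnion]
    constructor
    · intro hx
      exact ⟨_, (hsons s _).2 ⟨c x (List.length (α := ℕ) s), rfl⟩,
        mem_codeCylinder_append.2 ⟨hx, rfl⟩⟩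
    · rintro ⟨t, ht, hx⟩
      obtain ⟨i, rfl⟩ := (hsons s t).1 ht
      exact (mem_codeCylinder_append.1 hx).1
  · intro t ht t' ht' hne
    obtain ⟨i, rfl⟩ := (hsons s t).1 ht
    obtain ⟨j, rfl⟩ := (hsons s t').1 ht'
    refine disjoint_left.2 fun x hi hj => hne ?_
    rw [← (mem_codeCylinder_append.1 hi).2, ← (mem_codeCylinder_append.1 hj).2]
  · obtain ⟨t, ht⟩ := SeqTree.exists_initSeg_mem hB
    obtain ⟨p, rfl⟩ := hc.2 t
    refine ⟨p, Subset.antisymm (fun x hx => hc.1 (funext fun i => ?_)) ?_⟩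
    · have := mem_iInter₂.1 hx _ (ht (i + 1))
      exact mem_codeCylinder_initSeg.1 this i (Nat.lt_succ_self i)
    · intro x hx
      obtain rfl : p = x := hx.symm
      refine mem_iInter₂.2 fun s hs => ?_
      have hl : (initSeg (c p) (List.length (α := ℕ) s)).length = List.length (α := ℕ) s := by simp
      rcases hB.1.total hs (ht (List.length (α := ℕ) s)) with h | h
      · exact (List.IsPrefix.eq_of_length h hl.symm).symm
      · exact List.IsPrefix.eq_of_length h hl
  · exact eq_univ_of_forall fun x => rfl
  · obtain ⟨n, m, hm⟩ := hgrow p U hU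
    refine ⟨initSeg (c p) n, mem_codeCylinder_initSeg.2 fun _ _ => rfl, ?_⟩
    rintro _ rfl -
    let C : Set F.Node := {t | ∃ i, m ≤ i ∧ t = initSeg (c p) n ++ [i]}
    refine ⟨F.flesh C, ⟨C, ?_, ?_, rfl⟩, ?_, ?_⟩
    · rintro _ ⟨i, _, rfl⟩
      exact (hsons _ _).2 ⟨i, rfl⟩
    · refine ((finite_Iio m).image fun i => ((initSeg (c p) n ++ [i] : List ℕ) : F.Node)).subset ?_
      rintro t ⟨ht, htC⟩
      obtain ⟨i, rfl⟩ := (hsons _ t).1 ht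
      exact ⟨i, lt_of_not_ge fun h => htC ⟨i, h, rfl⟩, rfl⟩
    · obtain ⟨x, hx⟩ := hc.2 fun i => if i < n then c p i else m
      refine ⟨x, mem_biUnion (x := (initSeg (c p) n ++ [m] : List ℕ)) ⟨m, le_rfl, rfl⟩ ?_⟩
      refine mem_codeCylinder_append.2 ⟨mem_codeCylinder_initSeg.2 fun i hi => ?_, ?_⟩
      · simp [hx, hi]
      · simp [hx]
    · intro y hy
      obtain ⟨t, ⟨i, hi, rfl⟩, hyt⟩ := mem_iUnion₂.1 hy
      obtain ⟨h1, h2⟩ := mem_codeCylinder_append.1 hyt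
      rw [length_initSeg] at h2
      exact hm y (mem_codeCylinder_initSeg.1 h1) (h2 ▸ hi)

/-! ### Renumbering an infinitely branching closed tree -/

open Classical in
/-- A closed set of infinite sequences whose tree of initial segments is everywhere infinitely
branching can be renumbered to be the set of all infinite sequences. -/
theorem hasPiTree_of_closed_range {X : Type u} [TopologicalSpace X] [Nonempty X]
    (g : X → ℕ → ℕ) (hinj : Function.Injective g)
    (hclosed : ∀ t : ℕ → ℕ, (∀ n, ∃ x, ∀ i < n, g x i = t i) → ∃ x, g x = t)
    (hinf : ∀ x n, {t | ∃ y, (∀ i < n, g y i = g x i) ∧ g y n = t}.Infinite)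
    (hcont : ∀ n, Continuous fun x => g x n)
    (hgrow : ∀ p, ∀ U ∈ 𝓝 p, ∃ n, GrowsAt g p U n) : HasPiTree X := by
  -- `P x n` is the set of values that can follow the first `n` terms of `g x`; `c` replaces each
  -- value by its rank in this infinite set.
  let P : X → ℕ → ℕ → Prop := fun x n t => ∃ y, (∀ i < n, g y i = g x i) ∧ g y n = t
  let c : X → ℕ → ℕ := fun x n => Nat.count (P x n) (g x n)
  have hPself : ∀ x n, P x n (g x n) := fun x n => ⟨x, fun _ _ => rfl, rfl⟩
  have hP : ∀ x y n, (∀ i < n, g y i = g x i) → P y n = P x n := by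
    intro x y n h
    funext t
    refine propext ⟨?_, ?_⟩
    · rintro ⟨z, h1, h2⟩
      exact ⟨z, fun i hi => (h1 i hi).trans (h i hi), h2⟩
    · rintro ⟨z, h1, h2⟩
      exact ⟨z, fun i hi => (h1 i hi).trans (h i hi).symm, h2⟩
  have hcg : ∀ x y n, (∀ i < n, g y i = g x i) → g y n = g x n → c y n = c x n := by
    intro x y n h h'
    simp only [c, hP x y n h, h']
  have hgc : ∀ x y n, (∀ i < n, c y i = c x i) → ∀ i < n, g y i = g x i := by
    intro x y n
    induction n with
    | zero => intro _ i hi; omega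
    | succ n ih =>
      intro h
      have h1 := ih fun i hi => h i (by omega)
      have h2 := h n (by omega)
      simp only [c, hP x y n h1] at h2
      have h3 := Nat.count_injective (hP x y n h1 ▸ hPself y n) (hPself x n) h2
      intro i hi
      rcases Nat.lt_succ_iff_lt_or_eq.1 hi with h | rfl
      · exact h1 i h
      · exact h3
  refine hasPiTree_of_bijective c ⟨?_, ?_⟩ ?_ ?_
  · intro x y hxy
    exact hinj (funext fun i => hgc y x (i + 1) (fun j _ => congrFun hxy j) i (Nat.lt_succ_self i))
  · intro t
    have hstep : ∀ n x, ∃ y, (∀ i < n, g y i = g x i) ∧ c y n = t n := by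
      intro n x
      obtain ⟨y, hy, hyn⟩ : P x n (Nat.nth (P x n) (t n)) := Nat.nth_mem_of_infinite (hinf x n) _
      refine ⟨y, hy, ?_⟩
      simp only [c, hP x y n hy, hyn]
      exact Nat.count_nth_of_infinite (hinf x n) _
    choose f hf1 hf2 using hstep
    let s : ℕ → X := fun n => Nat.rec (Classical.arbitrary X) (fun n x => f n x) n
    have hs : ∀ n, ∀ i < n, g (s n) i = g (s (i + 1)) i := by
      intro n
      induction n with
      | zero => intro i hi; omega
      | succ n ih =>
        intro i hi
        rcases Nat.lt_succ_iff_lt_or_eq.1 hi with h | rfl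
        · exact (hf1 n (s n) i h).trans (ih i h)
        · rfl
    obtain ⟨x, hx⟩ := hclosed (fun i => g (s (i + 1)) i) fun n => ⟨s n, hs n⟩
    refine ⟨x, funext fun n => ?_⟩
    have hxs : ∀ i < n + 1, g x i = g (s (n + 1)) i := fun i hi => by
      rw [hs _ i hi, hx]
    rw [hcg (s (n + 1)) x n (fun i hi => hxs i (by omega)) (hxs n (by omega))]
    exact hf2 n (s n)
  · intro n
    rw [continuous_discrete_rng]
    intro k
    rw [isOpen_iff_mem_nhds]
    intro x hx
    have hev : ∀ i ∈ Finset.range (n + 1), ∀ᶠ y in 𝓝 x, g y i = g x i := fun i _ =>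
      (hcont i).continuousAt.eventually_mem ((isOpen_discrete {g x i}).mem_nhds rfl)
    filter_upwards [(Filter.eventually_all_finset _).2 hev] with y hy
    exact (hcg x y n (fun i hi => hy i (by simp; omega)) (hy n (by simp))).trans hx
  · intro p U hU
    obtain ⟨n, m, hm⟩ := hgrow p U hU
    -- Rank is strictly increasing on admissible values, so a rank of at least that of `m` forces a
    -- value of at least `m`.
    refine ⟨n, Nat.count (P p n) m, fun y h1 h2 => ?_⟩
    have h1' := hgc p y n h1
    refine hm y h1' (le_of_not_gt fun hlt => ?_)
    have h3 : P p n (g y n) := hP p y n h1' ▸ hPself y n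
    have h4 : c y n = Nat.count (P p n) (g y n) := by simp only [c, hP p y n h1']
    have := Nat.count_strict_mono h3 hlt
    omega

/-! ### Merging countably many codes into one -/

theorem exists_monotone_finset_cover {B : Type*} [Countable B] (b₀ : B) :
    ∃ S : ℕ → Finset B, Monotone S ∧ (∀ k, b₀ ∈ S k) ∧ ∀ b, ∃ k, b ∈ S k := by
  classical
  have : Nonempty B := ⟨b₀⟩
  obtain ⟨f, hf⟩ := exists_surjective_nat B
  refine ⟨fun k => insert b₀ ((Finset.range k).image f), fun k l h => ?_, fun k => by simp,
    fun b => ?_⟩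
  · exact Finset.insert_subset_insert _ (Finset.image_subset_image (by simpa using h))
  · obtain ⟨k, rfl⟩ := hf b
    exact ⟨k + 1, Finset.mem_insert_of_mem (Finset.mem_image_of_mem _ (by simp))⟩

/-- A space coded by countably many infinite sequences has a π-tree, provided that all the finite
families of coordinates grow simultaneously at arbitrarily high levels. -/
theorem hasPiTree_of_levels {Z : Type u} [TopologicalSpace Z] {B : Type*} [Countable B]
    (φ : Z ≃ (B → ℕ → ℕ)) (lev : B → ℕ → ℕ) (hlev : ∀ b, StrictMono (lev b))
    (b₀ : B) (hb₀ : ∀ k, lev b₀ k + 2 ≤ lev b₀ (k + 1))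
    (hcont : ∀ b i, Continuous fun z => φ z b i)
    (hgrow : ∀ p, ∀ U ∈ 𝓝 p, ∃ I : Finset B, ∀ K, ∃ k ≥ K, ∃ m, ∀ y,
      (∀ b ∈ I, (∀ i < lev b k, φ y b i = φ p b i) ∧ m ≤ φ y b (lev b k)) → y ∈ U) :
    HasPiTree Z := by
  obtain ⟨S, hSmono, hS₀, hScov⟩ := exists_monotone_finset_cover b₀
  choose kb hkb using hScov
  have hSne : ∀ k, (S k).Nonempty := fun k => ⟨b₀, hS₀ k⟩
  let Agree : Z → Z → ℕ → Prop := fun x y k => ∀ b ∈ S k, ∀ i < lev b (k + 1), φ y b i = φ x b i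
  obtain ⟨cd, hcd⟩ : ∃ cd : Z → ℕ → ℕ, ∀ x y k, cd y k = cd x k ↔ Agree x y k := by
    have : ∀ k, ∃ f : (∀ b : S k, Fin (lev b (k + 1)) → ℕ) → ℕ, Function.Injective f := fun k =>
      Countable.exists_injective_nat _
    choose f hf using this
    refine ⟨fun z k => f k fun b i => φ z b i, fun x y k => ?_⟩
    rw [(hf k).eq_iff]
    constructor
    · intro h b hb i hi
      exact congrFun (congrFun h ⟨b, hb⟩) ⟨i, hi⟩
    · intro h
      funext b i
      exact h b b.2 i i.2
  let mn : Z → ℕ → ℕ := fun z k => (S k).inf' (hSne k) fun b => φ z b (lev b k)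
  let g : Z → ℕ → ℕ := fun z n => if n % 2 = 0 then mn z (n / 2) else cd z (n / 2)
  have hg0 : ∀ z k, g z (2 * k) = mn z k := fun z k => by simp [g]
  have hg1 : ∀ z k, g z (2 * k + 1) = cd z k := fun z k => by
    have h1 : (2 * k + 1) % 2 = 1 := by omega
    have h2 : (2 * k + 1) / 2 = k := by omega
    simp only [g, h1, h2]
    simp
  have hmn : ∀ x y k, (∀ b ∈ S k, φ y b (lev b k) = φ x b (lev b k)) → mn y k = mn x k :=
    fun x y k h => Finset.inf'_congr _ rfl h
  have hAmono : ∀ x y j k, j ≤ k → Agree x y k → Agree x y j := fun x y j k hjk h b hb i hi =>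
    h b (hSmono hjk hb) i (hi.trans_le ((hlev b).monotone (by omega)))
  have hAg : ∀ x y k, Agree x y k → ∀ i < 2 * k + 2, g y i = g x i := by
    intro x y k h i hi
    rcases Nat.even_or_odd' i with ⟨j, rfl | rfl⟩
    · rw [hg0, hg0]
      exact hmn x y j fun b hb => hAmono x y j k (by omega) h b hb _ (hlev b (Nat.lt_succ_self j))
    · rw [hg1, hg1, hcd]
      exact hAmono x y j k (by omega) h
  have hgA : ∀ x y k, (∀ i < 2 * k + 2, g y i = g x i) → Agree x y k := by
    intro x y k h
    have := h (2 * k + 1) (by omega)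
    rwa [hg1, hg1, hcd] at this
  have hlow : ∀ x y k, (∀ b ∈ S k, ∀ i < lev b k, φ y b i = φ x b i) →
      ∀ i < 2 * k, g y i = g x i := by
    intro x y k h
    rcases k with _ | k
    · intro i hi; omega
    · exact hAg x y k fun b hb i hi => h b (hSmono (Nat.le_succ k) hb) i hi
  have hid : ∀ b k, k ≤ lev b k := fun b k => (hlev b).le_apply
  have : Nonempty Z := ⟨φ.symm fun _ _ => 0⟩
  refine hasPiTree_of_closed_range g ?_ ?_ ?_ ?_ ?_
  · intro x y hxy
    refine φ.injective (funext fun b => funext fun i => ?_)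
    refine hgA y x (max (kb b) i) (fun j _ => congrFun hxy j) b
      (hSmono (le_max_left _ _) (hkb b)) i ?_
    exact lt_of_lt_of_le (by have := le_max_right (kb b) i; omega) (hid b _)
  · intro t ht
    choose w hw using ht
    -- The entry `(b, i)` is read off at a stage so late that `b` has entered `S` and `i` is below
    -- the encoded level; from then on the entry is stable.
    let x : Z := φ.symm fun b i => φ (w (2 * max (kb b) i + 2)) b i
    have key : ∀ k, Agree (w (2 * k + 2)) x k := by
      intro k b hb i hi
      simp only [x, Equiv.apply_symm_apply]
      rcases le_total k (max (kb b) i) with h | h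
      · refine hgA _ _ k (fun j hj => ?_) b hb i hi
        rw [hw _ j (by omega), hw _ j hj]
      · refine hgA _ _ (max (kb b) i) (fun j hj => ?_) b (hSmono (le_max_left _ _) (hkb b)) i ?_
        · rw [hw _ j (by omega), hw _ j (by omega)]
        · exact lt_of_lt_of_le (by have := le_max_right (kb b) i; omega) (hid b _)
    refine ⟨x, funext fun n => ?_⟩
    rw [hAg _ _ _ (key n) n (by omega)]
    exact hw _ n (by omega)
  · intro x n
    rcases Nat.even_or_odd' n with ⟨k, rfl | rfl⟩
    · refine Set.infinite_of_injective_forall_mem (f := fun m : ℕ => m) (fun _ _ h => h) fun m => ?_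
      -- Every entry from the `k`-th level on is set to `m`, so the minimum is `m`.
      let y : Z := φ.symm fun b i => if i < lev b k then φ x b i else m
      refine ⟨y, hlow x y k fun b _ i hi => by simp [y, hi], ?_⟩
      rw [hg0]
      simp only [mn, y, Equiv.apply_symm_apply, lt_irrefl, if_false]
      exact Finset.inf'_const _ _
    -- The entries at the `k`-th levels stay fixed, to preserve the minimum. The gap of 2 for `b₀`
    -- leaves an entry strictly between two levels that is encoded yet free.
    · let y : ℕ → Z := fun m => φ.symm fun b i => if i ≤ lev b k then φ x b i else m
      refine Set.infinite_of_injective_forall_mem (f := fun m => g (y m) (2 * k + 1)) ?_ fun m => ?_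
      · intro m m' h
        simp only [hg1, hcd] at h
        have := h b₀ (hS₀ k) (lev b₀ k + 1) (by have := hb₀ k; omega)
        simpa [y] using this
      · refine ⟨y m, fun i hi => ?_, rfl⟩
        rcases Nat.lt_succ_iff_lt_or_eq.1 hi with h | rfl
        · exact hlow x (y m) k (fun b _ i hi => by simp [y, hi.le]) i h
        · rw [hg0, hg0]
          exact hmn _ _ _ fun b _ => by simp [y]
  · intro n
    refine ((IsLocallyConstant.iff_eventually_eq _).2 fun x => ?_).continuous
    have hev : ∀ b ∈ S n, ∀ᶠ y in 𝓝 x, ∀ i ∈ Finset.range (lev b (n + 1)), φ y b i = φ x b i :=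
      fun b _ => (Filter.eventually_all_finset _).2 fun i _ =>
        ((IsLocallyConstant.iff_continuous _).2 (hcont b i)).eventually_eq x
    filter_upwards [(Filter.eventually_all_finset _).2 hev] with y hy
    exact hAg x y n (fun b hb i hi => hy b hb i (Finset.mem_range.2 hi)) n (by omega)
  · intro p U hU
    obtain ⟨I, hI⟩ := hgrow p U hU
    obtain ⟨k, hk, m, hm⟩ := hI (I.sup kb + 1)
    -- Agreement below the level `j + 1` is recorded by the odd term `2j + 1`, which requires `I ⊆ S
    -- j`.
    obtain ⟨k, rfl⟩ : ∃ j, k = j + 1 := ⟨k - 1, by omega⟩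
    refine ⟨2 * (k + 1), m, fun y h1 h2 => hm y fun b hb => ?_⟩
    have hbk : b ∈ S k := hSmono ((Finset.le_sup hb).trans (by omega)) (hkb b)
    refine ⟨hgA p y k h1 b hbk, ?_⟩
    rw [hg0] at h2
    exact h2.trans (Finset.inf'_le _ (hSmono (Nat.le_succ k) hbk))

/-! ### Choosing the levels -/

/-- If `n < M`, a point that agrees with `p` below `n` and has a huge `n`-th term leaves the
cylinder. Shrinking a neighbourhood to a cylinder thus pushes its growth levels up. -/
theorem le_of_growsAt_cylinder {X : Type*} (c : X ≃ (ℕ → ℕ)) {p : X} {M n : ℕ}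
    (h : GrowsAt c p {y | ∀ i < M, c y i = c p i} n) : M ≤ n := by
  obtain ⟨m, hm⟩ := h
  by_contra! hlt
  have := hm (c.symm fun i => if i < n then c p i else m + c p n + 1)
    (fun i hi => by simp [hi]) (by simp; omega) n hlt
  simp at this
  omega

theorem cylinder_mem_nhds {X : Type*} [TopologicalSpace X] {c : X → ℕ → ℕ}
    (hc : ∀ n, Continuous fun x => c x n) (p : X) (M : ℕ) :
    {y | ∀ i < M, c y i = c p i} ∈ 𝓝 p := by
  have : ∀ i ∈ Finset.range M, ∀ᶠ y in 𝓝 p, c y i = c p i := fun i _ =>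
    ((IsLocallyConstant.iff_continuous _).2 (hc i)).eventually_eq p
  filter_upwards [(Filter.eventually_all_finset _).2 this] with y hy i hi
  exact hy i (Finset.mem_range.2 hi)

namespace FoliageTree

variable {X : Type u} [TopologicalSpace X] {F : FoliageTree.{u, v} X}

/-- A countable family with the finite intersection property that π-refines `Rise` has an infinite
pseudo-intersection. -/
theorem exists_levels {c : X ≃ (ℕ → ℕ)} (hc : ∀ n, Continuous fun x => c x n)
    (hrise : ∀ p, ∀ U ∈ 𝓝 p, ∀ n ∈ F.rise p U, GrowsAt c p U n)
    (hne : ∀ p, ∀ U ∈ 𝓝 p, (F.rise p U).Nonempty) {γ : Set (Set ℕ)} (hγc : γ.Countable)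
    (hγ : HasFIP γ) (hγF : PiRefines γ F.riseFamily) :
    ∃ ν : ℕ → ℕ, (∀ k, ν k + 2 ≤ ν (k + 1)) ∧
      ∀ p, ∀ U ∈ 𝓝 p, ∃ K, ∀ k ≥ K, GrowsAt c p U (ν k) := by
  have href : ∀ p, ∀ U ∈ 𝓝 p, ∃ G ∈ γ, G ⊆ F.rise p U := fun p U hU => by
    obtain ⟨G, hG, -, hGU⟩ := hγF _ ⟨p, U, hU, rfl⟩ (hne p U hU)
    exact ⟨G, hG, hGU⟩
  let p₀ : X := c.symm fun _ => 0
  have hγne : γ.Nonempty := by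
    obtain ⟨G, hG, -⟩ := href p₀ univ Filter.univ_mem
    exact ⟨G, hG⟩
  obtain ⟨e, rfl⟩ := hγc.exists_eq_range hγne
  have hbig : ∀ k M, ∃ n ≥ M, ∀ i ≤ k, n ∈ e i := by
    intro k M
    obtain ⟨_, ⟨j, rfl⟩, hj⟩ := href p₀ _ (cylinder_mem_nhds hc p₀ M)
    -- Adding a member `e j` inside the rise of a cylinder of length `M` to the finite subfamily
    -- makes the common element at least `M`.
    obtain ⟨n, hn⟩ := hγ (e '' insert j (Iic k)) (image_subset_range _ _)
      (((finite_Iic k).insert j).image e) ((insert_nonempty _ _).image e)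
    rw [sInter_image] at hn
    have hn' := mem_iInter₂.1 hn
    exact ⟨n, le_of_growsAt_cylinder c
      (hrise p₀ _ (cylinder_mem_nhds hc p₀ M) n (hj (hn' j (mem_insert _ _)))),
      fun i hi => hn' i (mem_insert_of_mem _ hi)⟩
  choose f hf1 hf2 using hbig
  let ν : ℕ → ℕ := fun k => Nat.rec (f 0 0) (fun k v => f (k + 1) (v + 2)) k
  refine ⟨ν, fun k => hf1 _ _, fun p U hU => ?_⟩
  obtain ⟨_, ⟨j, rfl⟩, hj⟩ := href p U hU
  refine ⟨j, fun k hk => hrise p U hU _ (hj ?_)⟩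
  rcases k with _ | k
  · exact hf2 0 0 j hk
  · exact hf2 (k + 1) (ν k + 2) j hk

end FoliageTree

/-! ### Products -/

/-- Only finitely many factors are restricted, so the maximum of their thresholds serves for `K`,
and likewise for `m`. -/
theorem exists_levels_of_pi {A : Type*} {X : A → Type*} [∀ α, TopologicalSpace (X α)]
    {c : ∀ α, X α → ℕ → ℕ} {ν : A → ℕ → ℕ}
    (hν : ∀ α, ∀ p, ∀ U ∈ 𝓝 p, ∃ K, ∀ k ≥ K, GrowsAt (c α) p U (ν α k))
    (p : ∀ α, X α) {U : Set (∀ α, X α)} (hU : U ∈ 𝓝 p) :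
    ∃ (I : Finset A) (K : ℕ), ∀ k ≥ K, ∃ m, ∀ y : ∀ α, X α,
      (∀ α ∈ I, (∀ i < ν α k, c α (y α) i = c α (p α) i) ∧ m ≤ c α (y α) (ν α k)) → y ∈ U := by
  rw [nhds_pi, Filter.mem_pi'] at hU
  obtain ⟨I, t, ht, htU⟩ := hU
  choose K hK using fun α => hν α (p α) (t α) (ht α)
  refine ⟨I, I.sup K, fun k hk => ?_⟩
  have : ∀ α : A, ∃ m, α ∈ I → ∀ y, (∀ i < ν α k, c α y i = c α (p α) i) →
      m ≤ c α y (ν α k) → y ∈ t α := by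
    intro α
    by_cases hα : α ∈ I
    · obtain ⟨m, hm⟩ := hK α k ((Finset.le_sup hα).trans hk)
      exact ⟨m, fun _ => hm⟩
    · exact ⟨0, fun h => absurd h hα⟩
  choose m hm using this
  refine ⟨I.sup m, fun y hy => htU fun α hα => ?_⟩
  exact hm α hα (y α) (hy α hα).1 ((Finset.le_sup hα).trans (hy α hα).2)

theorem mainTheorem2 {A : Type*} [Nonempty A] [Countable A]
    (X : A → Type*) [∀ α, TopologicalSpace (X α)]
    (F : ∀ α, FoliageTree (X α)) (hF : ∀ α, (F α).IsPiTree)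
    (hγ : ∀ α, ∃ γ : Set (Set ℕ), γ.Countable ∧ HasFIP γ ∧ PiRefines γ (F α).riseFamily) :
    HasPiTree (∀ α, X α) ∧
      ∀ (Y : Type*) [TopologicalSpace Y] (G : FoliageTree Y), G.IsPiTree →
        HasFIP G.riseFamily → HasPiTree (Y × ∀ α, X α) := by
  choose c hc hrise hne using fun α => (hF α).exists_coding
  have hlev : ∀ α, ∃ ν : ℕ → ℕ, (∀ k, ν k + 2 ≤ ν (k + 1)) ∧
      ∀ p, ∀ U ∈ 𝓝 p, ∃ K, ∀ k ≥ K, GrowsAt (c α) p U (ν k) := by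
    intro α
    obtain ⟨γ, h1, h2, h3⟩ := hγ α
    exact FoliageTree.exists_levels (hc α) (hrise α) (hne α) h1 h2 h3
  choose ν hgap hν using hlev
  have hmono : ∀ α, StrictMono (ν α) := fun α =>
    strictMono_nat_of_lt_succ fun k => by have := hgap α k; omega
  obtain ⟨a⟩ := ‹Nonempty A›
  constructor
  · refine hasPiTree_of_levels (Equiv.piCongrRight c) ν hmono a (hgap a)
      (fun α i => (hc α i).comp (continuous_apply α)) fun p U hU => ?_
    obtain ⟨I, K, hI⟩ := exists_levels_of_pi hν p hU
    exact ⟨I, fun K' => ⟨max K K', le_max_right _ _, hI _ (le_max_left _ _)⟩⟩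
  · intro Y _ G hG _
    obtain ⟨d, hd, hdrise, hdne⟩ := hG.exists_coding
    let φ : (Y × ∀ α, X α) ≃ (Option A → ℕ → ℕ) :=
      (Equiv.prodCongr d (Equiv.piCongrRight c)).trans
        (Equiv.piOptionEquivProd (β := fun _ : Option A => ℕ → ℕ)).symm
    have hφn : ∀ z, φ z none = d z.1 := fun _ => rfl
    have hφs : ∀ z α, φ z (some α) = c α (z.2 α) := fun _ _ => rfl
    let lev : Option A → ℕ → ℕ := fun o => o.elim id ν
    refine hasPiTree_of_levels φ lev ?_ (some a) (hgap a) ?_ fun p U hU => ?_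
    · rintro (_ | α)
      · exact strictMono_id
      · exact hmono α
    · rintro (_ | α) i
      · exact (hd i).comp continuous_fst
      · exact (hc α i).comp ((continuous_apply α).comp continuous_snd)
    · rw [nhds_prod_eq, Filter.mem_prod_iff] at hU
      obtain ⟨V, hV, W, hW, hVW⟩ := hU
      obtain ⟨I, K, hI⟩ := exists_levels_of_pi hν p.2 hW
      refine ⟨I.insertNone, fun K' => ?_⟩
      -- Intersecting `V` with a long cylinder forces the level `k` found in `Y` past both `K` and
      -- `K'`, where the factors `X α` with `α ∈ I` grow as well.
      have hV' := Filter.inter_mem hV (cylinder_mem_nhds hd p.1 (max K K'))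
      obtain ⟨k, hk⟩ := hdne p.1 _ hV'
      have hgr := hdrise p.1 _ hV' k hk
      have hle := le_of_growsAt_cylinder d (hgr.mono inter_subset_right)
      obtain ⟨m₁, hm₁⟩ := hgr.mono inter_subset_left
      obtain ⟨m₂, hm₂⟩ := hI k ((le_max_left _ _).trans hle)
      refine ⟨k, (le_max_right _ _).trans hle, max m₁ m₂, fun y hy => hVW ⟨?_, ?_⟩⟩
      · have := hy none (by simp)
        exact hm₁ y.1 this.1 ((le_max_left _ _).trans this.2)
      · refine hm₂ y.2 fun α hα => ?_
        have := hy (some α) (by simpa using hα)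
        exact ⟨this.1, (le_max_right _ _).trans this.2⟩
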